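/- **Theorem 6.** Let $M$ be a compact connected smooth Riemannian manifold (without boundary), let $d$ be its Riemannian distance, and write $B(p,r)$ for the open $d$-ball. A $C^1$ local diffeomorphism $f:M\to M$ is called *expanding* if there are $\lambda>1$ and some Riemannian metric on $M$ with $\|Df(x)v\|\ge\lambda\|v\|$ for all $x\in M$, $v\in T_xM$. For $\sigma>1$ and $\rho>0$ let $\mathcal E(\sigma,\rho)$ be the set of expanding $C^1$ local diffeomorphisms $f:M\to M$ with expansion factor $\sigma$ and injectivity constant $\rho$, meaning that for every $p\in M$ the set $f(B(p,\rho))$ contains a neighborhood of the closure of $B(f(p),\rho)$, and $d(f(x),f(y))\ge\sigma\, d(x,y)$ for all $x,y\in B(p,\rho)$. Let $(M,\Phi)$ be a non-autonomous iterated function system (NAIFS), i.e. a sequence $\Phi^{(j)}=\{\varphi^{(j)}_i:M\to M\}_{i\in I^{(j)}}$, $j\ge1$, with each $I^{(j)}$ a finite non-empty index set. For $w=w_1w_2\ldots\in I^{1,\infty}:=\prod_{j\ge1}I^{(j)}$ put $\varphi_w^{1,0}=\mathrm{id}_M$ and $\varphi_w^{1,k}=\varphi^{(k)}_{w_k}\circ\cdots\circ\varphi^{(1)}_{w_1}$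 for $k\ge 1$. Suppose that $(M,\Phi)$ is uniformly expanding, i.e. that there are $\sigma>1$ and $\rho>0$ with $\varphi_i^{(j)}\in\mathcal E(\sigma,\rho)$ for all $j\ge1$ and $i\in I^{(j)}$. Then $(M,\Phi)$ satisfies the specification property: for every $\delta>0$ there is a positive integer $N=N(\delta)$ such that for every $w\in I^{1,\infty}$, every $s\ge2$, all $x_1,\dots,x_s\in M$ and all integers $0=j_1\le k_1<j_2\le k_2<\cdots<j_s\le k_s$ with $j_{m+1}-k_m\ge N$ for $m=1,\dots,s-1$, there is a point $x\in M$ with $$d\big(\varphi_w^{1,i}(x),\varphi_w^{1,i}(x_m)\big)\le\delta\qquad\text{for all }1\le m\le s\text{ and } j_m\le i\le k_m .$$ -/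

import Mathlib

open Set Metric
open scoped Manifold ContDiff Bundle Topology

universe u v

/-- A non-autonomous iterated function system on `X`: a sequence of finite non-empty families of
self-maps of `X`. The sequence is indexed from `0`, so that `map j` is the family `Φ^(j+1)` and
`index j` is its index set `I^(j+1)`. -/
structure NAIFS (X : Type u) where
  /-- The index sets. -/
  index : ℕ → Type v
  finite_index : ∀ j, Finite (index j)
  nonempty_index : ∀ j, Nonempty (index j)
  /-- The maps of the system. -/
  map : ∀ j, index j → X → X

namespace NAIFS

/-- The infinite words of the system, i.e. the elements of `I^(1,∞)`. -/
abbrev Word {X : Type u} (Φ : NAIFS.{u, v} X) : Type v := ∀ j, Φ.index j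

/-- The time evolution along the infinite word `w`: `Φ.iter w k` is the composition of the first
`k` maps selected by `w`, that is `φ_w^(1,k)`; it is the identity for `k = 0`. -/
def iter {X : Type u} (Φ : NAIFS.{u, v} X) (w : Φ.Word) : ℕ → X → X
  | 0 => id
  | k + 1 => Φ.map k (w k) ∘ iter Φ w k

/-- The specification property. The points `x 1, …, x s` and the times
`0 = j 1 ≤ k 1 < j 2 ≤ k 2 < ⋯ < j s ≤ k s` are given by sequences of which only the terms with
index in `{1, …, s}` matter. -/
def HasSpecification {X : Type u} [PseudoMetricSpace X] (Φ : NAIFS.{u, v} X) : Prop :=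
  ∀ δ : ℝ, 0 < δ → ∃ N : ℕ, 0 < N ∧
    ∀ (w : Φ.Word) (s : ℕ), 2 ≤ s → ∀ (x : ℕ → X) (j k : ℕ → ℕ),
      j 1 = 0 →
      (∀ m, 1 ≤ m → m ≤ s → j m ≤ k m) →
      (∀ m, 1 ≤ m → m < s → k m < j (m + 1)) →
      (∀ m, 1 ≤ m → m < s → k m + N ≤ j (m + 1)) →
      ∃ y : X, ∀ m, 1 ≤ m → m ≤ s → ∀ i, j m ≤ i → i ≤ k m →
        dist (Φ.iter w i y) (Φ.iter w i (x m)) ≤ δ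

end NAIFS

/-- A self-map `f` of a manifold is expanding if it is a `C^1` local diffeomorphism and there are
`σ > 1` and some smooth Riemannian metric for which `‖Df(x) v‖ ≥ σ ‖v‖` for every tangent
vector `v` at every point `x`. -/
def IsExpandingLocalDiffeo (n : ℕ) {M : Type u} [TopologicalSpace M]
    [ChartedSpace (EuclideanSpace ℝ (Fin n)) M] [IsManifold (𝓡 n) ∞ M] (f : M → M) : Prop :=
  IsLocalDiffeomorph (𝓡 n) (𝓡 n) 1 f ∧
    ∃ σ : ℝ, 1 < σ ∧
      ∃ g : Bundle.ContMDiffRiemannianMetric (𝓡 n) ∞ (EuclideanSpace ℝ (Fin n))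
          (fun x : M ↦ TangentSpace (𝓡 n) x),
        ∀ (x : M) (v : TangentSpace (𝓡 n) x),
          σ * √(g.inner x v v) ≤
            √(g.inner (f x) (mfderiv (𝓡 n) (𝓡 n) f x v) (mfderiv (𝓡 n) (𝓡 n) f x v))

/-- `f` has expansion factor `σ` and injectivity constant `ρ` with respect to the distance of `M`:
on each ball `B(p, ρ)` the map `f` expands distances by at least `σ`, and the image of `B(p, ρ)`
contains a neighborhood of the closure of `B(f p, ρ)`. -/
def HasExpansionConstants {M : Type u} [PseudoMetricSpace M] (f : M → M) (σ ρ : ℝ) : Prop :=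
  ∀ p : M, f '' ball p ρ ∈ 𝓝ˢ (closure (ball (f p) ρ)) ∧
    ∀ x ∈ ball p ρ, ∀ y ∈ ball p ρ, σ * dist x y ≤ dist (f x) (f y)

/-- The class `𝓔(σ, ρ)` of expanding `C^1` local diffeomorphisms of `M` with expansion factor `σ`
and injectivity constant `ρ`. -/
def ExpandingClass (n : ℕ) (M : Type u) [PseudoMetricSpace M]
    [ChartedSpace (EuclideanSpace ℝ (Fin n)) M] [IsManifold (𝓡 n) ∞ M] (σ ρ : ℝ) :
    Set (M → M) :=
  {f | IsExpandingLocalDiffeo n f ∧ HasExpansionConstants f σ ρ}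

/-- The system `(M, Φ)` is uniformly expanding with uniform expansion factor `σ > 1` and
injectivity constant `ρ > 0`: all its maps lie in `𝓔(σ, ρ)`. -/
def NAIFS.IsUniformlyExpanding (n : ℕ) {M : Type u} [PseudoMetricSpace M]
    [ChartedSpace (EuclideanSpace ℝ (Fin n)) M] [IsManifold (𝓡 n) ∞ M]
    (Φ : NAIFS.{u, v} M) (σ ρ : ℝ) : Prop :=
  1 < σ ∧ 0 < ρ ∧ ∀ (j : ℕ) (i : Φ.index j), Φ.map j i ∈ ExpandingClass n M σ ρ

/-!
Lifting step by step along contracting inverse branches, every point within `ρ` of `φ_w^(1,k) p` is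
`φ_w^(1,k) y` for some `y` whose orbit approaches that of `p` exponentially fast backwards in time.
By connectedness and total boundedness, every point can be joined to `φ_w^(1,k) p` by a chain of at
most `K` jumps shorter than `ρ`, with `K` uniform. Lifting the jumps one after the other, every
point is `φ_w^(1,k) y` for some `y` with
`d(φ_w^(1,i) y, φ_w^(1,i) p) ≤ K ρ σ^(-(k - i))` for all `i ≤ k`. Orbit segments are then glued
from the last to the first: replacing the past of a point before time `j (t + 1)` by one that
shadows `x t` up to time `k t` does not change its orbit from time `j (t + 1)` on.
-/

section Chains

theorem iterate_thickening_subset_of_subset {X : Type u} [PseudoEMetricSpace X] (ε : ℝ) (n : ℕ)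
    {s t : Set X} (hst : s ⊆ t) : (thickening ε)^[n] s ⊆ (thickening ε)^[n] t :=
  Monotone.iterate (fun _ _ ↦ thickening_subset_of_subset ε) n hst

theorem monotone_iterate_thickening {X : Type u} [PseudoEMetricSpace X] {ε : ℝ} (hε : 0 < ε)
    (s : Set X) : Monotone fun n : ℕ ↦ (thickening ε)^[n] s :=
  Monotone.monotone_iterate_of_le_map (fun _ _ ↦ thickening_subset_of_subset ε)
    (self_subset_thickening hε s)

variable {X : Type u} [PseudoMetricSpace X] {ε : ℝ}

theorem exists_mem_iterate_thickening [PreconnectedSpace X] (hε : 0 < ε) (a b : X) :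
    ∃ n, b ∈ (thickening ε)^[n] {a} := by
  refine PreconnectedSpace.induction₂' (fun a b ↦ ∃ n, b ∈ (thickening ε)^[n] {a}) (fun a ↦ ?_)
    ⟨fun a b c ⟨m, hb⟩ ⟨n, hc⟩ ↦ ⟨n + m, ?_⟩⟩ a b
  · filter_upwards [ball_mem_nhds a hε] with b hb
    have hab : dist b a < ε := hb
    exact ⟨⟨1, by simpa using hab⟩, ⟨1, by simpa [dist_comm] using hab⟩⟩
  · rw [Function.iterate_add_apply]
    exact iterate_thickening_subset_of_subset ε n (singleton_subset_iff.2 hb) hc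

theorem exists_forall_mem_iterate_thickening [PreconnectedSpace X]
    (hX : TotallyBounded (univ : Set X)) (hε : 0 < ε) :
    ∃ n, ∀ a b : X, b ∈ (thickening ε)^[n] {a} := by
  obtain ⟨net, net_finite, net_covers⟩ := totallyBounded_iff.1 hX ε hε
  have near_net (x : X) : ∃ c ∈ net, dist x c < ε := by simpa using net_covers (mem_univ x)
  choose len hlen using exists_mem_iterate_thickening (X := X) hε
  obtain ⟨n, hn⟩ := ((net_finite.prod net_finite).image (Function.uncurry len)).bddAbove
  refine ⟨n + 2, fun a b ↦ ?_⟩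
  obtain ⟨c, hc, hac⟩ := near_net a
  obtain ⟨d, hd, hbd⟩ := near_net b
  have hcd : d ∈ (thickening ε)^[n] {c} :=
    monotone_iterate_thickening hε {c} (hn (mem_image_of_mem _ (mk_mem_prod hc hd))) (hlen c d)
  have hca : {c} ⊆ thickening ε {a} := by simpa [dist_comm] using hac
  rw [Function.iterate_succ_apply', Function.iterate_succ_apply]
  exact mem_thickening_iff.2 ⟨d, iterate_thickening_subset_of_subset ε n hca hcd, hbd⟩

end Chains

theorem HasExpansionConstants.exists_eq_and_mul_dist_le {X : Type u} [PseudoMetricSpace X]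
    {f : X → X} {σ ρ : ℝ} (hf : HasExpansionConstants f σ ρ) {p z : X} (hz : dist z (f p) < ρ) :
    ∃ y, f y = z ∧ σ * dist y p ≤ dist z (f p) := by
  obtain ⟨image_mem, expands⟩ := hf p
  obtain ⟨y, hy, rfl⟩ := subset_of_mem_nhdsSet image_mem (subset_closure (mem_ball.2 hz))
  exact ⟨y, rfl, expands y hy p (mem_ball_self (dist_nonneg.trans_lt hz))⟩

namespace NAIFS

section Iter

variable {X : Type u} (Φ : NAIFS.{u, v} X) (w : Φ.Word)

theorem iter_succ_apply (k : ℕ) (x : X) :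
    Φ.iter w (k + 1) x = Φ.map k (w k) (Φ.iter w k x) :=
  rfl

variable {Φ w}

theorem iter_eq_of_le {x y : X} {a i : ℕ} (hai : a ≤ i) (h : Φ.iter w a x = Φ.iter w a y) :
    Φ.iter w i x = Φ.iter w i y := by
  induction i, hai using Nat.le_induction with
  | base => exact h
  | succ i _ ih => rw [iter_succ_apply, iter_succ_apply, ih]

end Iter

section Exactness

variable {X : Type u} [PseudoMetricSpace X] (Φ : NAIFS.{u, v} X)

/-- The closed Bowen ball (dynamical ball) of radius `δ` around `p`: the points whose orbit along
the word `w` stays within `δ` of that of `p` up to time `n`, time `n` included. -/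
def bowenBall (w : Φ.Word) (n : ℕ) (p : X) (δ : ℝ) : Set X :=
  {y | ∀ i ≤ n, dist (Φ.iter w i y) (Φ.iter w i p) ≤ δ}

/-- Uniform topological exactness along Bowen balls: for each radius there is a waiting time `N`
after which the image of every Bowen ball is the whole space. The time `N` does not depend on
the word, the centre or the length of the Bowen ball. -/
def IsUniformlyExact : Prop :=
  ∀ δ : ℝ, 0 < δ → ∃ N : ℕ, ∀ (w : Φ.Word) (p : X) (n k : ℕ), n + N ≤ k →
    SurjOn (Φ.iter w k) (Φ.bowenBall w n p δ) univ

variable {Φ} {w : Φ.Word} {σ ρ : ℝ}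

theorem exists_iter_eq_of_dist_lt (hσ : 1 ≤ σ)
    (hw : ∀ j, HasExpansionConstants (Φ.map j (w j)) σ ρ) {k : ℕ} {p z : X}
    (hz : dist z (Φ.iter w k p) < ρ) :
    ∃ y, Φ.iter w k y = z ∧ ∀ i ≤ k,
      σ ^ (k - i) * dist (Φ.iter w i y) (Φ.iter w i p) ≤ dist z (Φ.iter w k p) := by
  induction k generalizing z with
  | zero => exact ⟨z, rfl, fun i hi ↦ by simp [Nat.le_zero.1 hi, iter]⟩
  | succ k ih =>
    rw [iter_succ_apply] at hz ⊢
    obtain ⟨z', rfl, hz'⟩ := (hw k).exists_eq_and_mul_dist_le hz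
    have hz'ρ : dist z' (Φ.iter w k p) < ρ :=
      (le_mul_of_one_le_left dist_nonneg hσ).trans_lt (hz'.trans_lt hz)
    obtain ⟨y, rfl, hy⟩ := ih hz'ρ
    refine ⟨y, rfl, fun i hi ↦ ?_⟩
    obtain hi | rfl := Nat.le_succ_iff.1 hi
    · calc σ ^ (k + 1 - i) * dist (Φ.iter w i y) (Φ.iter w i p)
          = σ * (σ ^ (k - i) * dist (Φ.iter w i y) (Φ.iter w i p)) := by
            rw [Nat.succ_sub hi, pow_succ', mul_assoc]
        _ ≤ σ * dist (Φ.iter w k y) (Φ.iter w k p) := by gcongr; exact hy i hi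
        _ ≤ dist (Φ.map k (w k) (Φ.iter w k y)) (Φ.map k (w k) (Φ.iter w k p)) := hz'
    · simp [iter_succ_apply]

theorem exists_iter_eq_of_mem_iterate_thickening (hσ : 1 ≤ σ)
    (hw : ∀ j, HasExpansionConstants (Φ.map j (w j)) σ ρ) {K k : ℕ} {p z : X}
    (hz : z ∈ (thickening ρ)^[K] {Φ.iter w k p}) :
    ∃ y, Φ.iter w k y = z ∧ ∀ i ≤ k,
      σ ^ (k - i) * dist (Φ.iter w i y) (Φ.iter w i p) ≤ K * ρ := by
  induction K generalizing z with
  | zero => exact ⟨p, (mem_singleton_iff.1 hz).symm, by simp⟩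
  | succ K ih =>
    rw [Function.iterate_succ_apply'] at hz
    obtain ⟨z', hz', hzz'⟩ := mem_thickening_iff.1 hz
    obtain ⟨y', rfl, hy'⟩ := ih hz'
    obtain ⟨y, rfl, hy⟩ := exists_iter_eq_of_dist_lt hσ hw hzz'
    refine ⟨y, rfl, fun i hi ↦ ?_⟩
    calc σ ^ (k - i) * dist (Φ.iter w i y) (Φ.iter w i p)
        ≤ σ ^ (k - i) * (dist (Φ.iter w i y) (Φ.iter w i y') +
            dist (Φ.iter w i y') (Φ.iter w i p)) := by gcongr; exact dist_triangle _ _ _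
      _ ≤ ρ + K * ρ := by rw [mul_add]; exact add_le_add ((hy i hi).trans hzz'.le) (hy' i hi)
      _ = (K + 1 : ℕ) * ρ := by push_cast; ring

theorem isUniformlyExact_of_hasExpansionConstants [PreconnectedSpace X]
    (hX : TotallyBounded (univ : Set X)) (hσ : 1 < σ) (hρ : 0 < ρ)
    (hΦ : ∀ j i, HasExpansionConstants (Φ.map j i) σ ρ) : Φ.IsUniformlyExact := by
  intro δ hδ
  obtain ⟨K, hK⟩ := exists_forall_mem_iterate_thickening hX hρ
  obtain ⟨N, hN⟩ := pow_unbounded_of_one_lt (K * ρ / δ) hσ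
  refine ⟨N, fun w p n k hnk z _ ↦ ?_⟩
  obtain ⟨y, hyz, hy⟩ := exists_iter_eq_of_mem_iterate_thickening hσ.le
    (fun j ↦ hΦ j (w j)) (hK (Φ.iter w k p) z)
  refine ⟨y, fun i hi ↦ ?_, hyz⟩
  refine le_of_mul_le_mul_left ?_ (by positivity : 0 < σ ^ N)
  calc σ ^ N * dist (Φ.iter w i y) (Φ.iter w i p)
      ≤ σ ^ (k - i) * dist (Φ.iter w i y) (Φ.iter w i p) := by
        gcongr
        · exact hσ.le
        · omega
    _ ≤ K * ρ := hy i (by omega)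
    _ ≤ σ ^ N * δ := ((div_lt_iff₀ hδ).1 hN).le

theorem IsUniformlyExact.hasSpecification (hΦ : Φ.IsUniformlyExact) : Φ.HasSpecification := by
  intro δ hδ
  obtain ⟨N, hN⟩ := hΦ δ hδ
  refine ⟨N + 1, N.succ_pos, fun w s hs x j k _ hjk _ hgap ↦ ?_⟩
  have glue : ∀ t, 1 ≤ t → t ≤ s → ∀ u, ∃ y, Φ.iter w (j t) y = Φ.iter w (j t) u ∧
      ∀ m, 1 ≤ m → m < t → ∀ i, j m ≤ i → i ≤ k m →
        dist (Φ.iter w i y) (Φ.iter w i (x m)) ≤ δ := by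
    intro t ht
    induction t, ht using Nat.le_induction with
    | base => exact fun _ u ↦ ⟨u, rfl, fun m _ _ ↦ by omega⟩
    | succ t ht ih =>
      intro hts u
      have hjkt := hjk t ht (by omega)
      have hgapt := hgap t ht (by omega)
      obtain ⟨v, hv, hvu⟩ := hN w (x t) (k t) (j (t + 1)) (by omega)
        (mem_univ (Φ.iter w (j (t + 1)) u))
      obtain ⟨y, hyv, hy⟩ := ih (by omega) v
      refine ⟨y, (iter_eq_of_le (by omega) hyv).trans hvu, fun m hm hmt i hji hik ↦ ?_⟩
      obtain hmt | rfl := Nat.lt_succ_iff_lt_or_eq.1 hmt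
      · exact hy m hm hmt i hji hik
      · rw [iter_eq_of_le hji hyv]
        exact hv i hik
  obtain ⟨y, hys, hy⟩ := glue s (by omega) le_rfl (x s)
  refine ⟨y, fun m hm hms i hji hik ↦ ?_⟩
  obtain hms | rfl := hms.lt_or_eq
  · exact hy m hm hms i hji hik
  · rw [iter_eq_of_le hji hys, dist_self]
    exact hδ.le

end Exactness

end NAIFS

theorem theorem6_general {X : Type u} [PseudoMetricSpace X] [PreconnectedSpace X]
    (hX : TotallyBounded (univ : Set X)) (Φ : NAIFS.{u, v} X) {σ ρ : ℝ} (hσ : 1 < σ) (hρ : 0 < ρ)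
    (hΦ : ∀ j i, HasExpansionConstants (Φ.map j i) σ ρ) : Φ.HasSpecification :=
  (NAIFS.isUniformlyExact_of_hasExpansionConstants hX hσ hρ hΦ).hasSpecification

theorem theorem6 {n : ℕ} {M : Type u} [MetricSpace M] [CompactSpace M] [ConnectedSpace M]
    [ChartedSpace (EuclideanSpace ℝ (Fin n)) M] [IsManifold (𝓡 n) ∞ M]
    [Bundle.RiemannianBundle (fun x : M ↦ TangentSpace (𝓡 n) x)]
    [IsContMDiffRiemannianBundle (𝓡 n) ∞ (EuclideanSpace ℝ (Fin n))
      (fun x : M ↦ TangentSpace (𝓡 n) x)]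
    [IsRiemannianManifold (𝓡 n) M]
    (Φ : NAIFS.{u, v} M) (σ ρ : ℝ) (hΦ : Φ.IsUniformlyExpanding n σ ρ) :
    Φ.HasSpecification :=
  theorem6_general isCompact_univ.totallyBounded Φ hΦ.1 hΦ.2.1 fun j i ↦ (hΦ.2.2 j i).2
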